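/- An LTE base station with $C\ge 1$ resource blocks and a WiFi access point with capacity $W$ serve voice and data users. A state $(i,j,k)$ consists of the numbers of voice users in LTE, data users in LTE and data users in WiFi; the state space $\mathcal S$ is given by $i+j\le C$, $k\le W$. Voice and data users arrive with rates $\lambda_v,\lambda_d>0$ and are served with rates $\mu_v,\mu_d>0$ each. Let $f(i,j,k)=iR_{L,V}+jR_{L,D}+kR_{W,D}(k)$ be the total throughput, with real bit rates $R_{L,V},R_{L,D}$ and per-user WiFi throughput $R_{W,D}(\cdot)$. The feasible actions and the resulting states are as follows. * Voice arrival: $A_1$ (block; state unchanged, feasible unless the state is $(0,0,0)$); $A_2$ (accept in LTE; to $(i+1,j,k)$, feasible if $i+j<C$); $A_4$ (accept in LTE and offload one LTE data user to WiFi; to $(i+1,j-1,k+1)$, feasible if $j\ge1$ and $k<W$). * Data arrival: $A_1$ (block; state unchanged, feasible only if $i+j=C$ and $k=W$); $A_2$ (to $(i,j+1,k)$, if $i+j<C$); $A_3$ (to $(i,j,k+1)$, if $k<W$). * Voice departure ($i\ge1$): $A_1$ (to $(i-1,j,k)$); $A_5$ (to $(i-1,j+1,k-1)$, if $k\ge1$).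 * Data departure from LTE ($j\ge1$): $A_1$ (to $(i,j-1,k)$); $A_5$ (to $(i,j,k-1)$, if $k\ge1$). * Data departure from WiFi ($k\ge1$): $A_1$ (to $(i,j,k-1)$); $A_5$ (to $(i,j-1,k)$, if $j\ge1$). When action $a$ is taken under event $E$ in state $s$, leading to $s'$, the reward is $\hat r(s,E,a)=f(s')-\beta$ if a voice user is blocked and $\hat r(s,E,a)=f(s')$ otherwise, where $\beta\in\mathbb R$ is a fixed Lagrange multiplier ($\beta=0$ for the unconstrained problem). Let $\delta>0$ satisfy $\delta(\lambda_v+\lambda_d+i\mu_v+j\mu_d+k\mu_d)\le1$ on $\mathcal S$. In one step of the uniformized discrete-time chain the five events have the probabilities $\hat p(s,E)$ equal to $\lambda_v\delta,\lambda_d\delta,i\mu_v\delta,j\mu_d\delta,k\mu_d\delta$, respectively; otherwise nothing happens. For a function $V$ put $$(TV)(s)=\sum_E\hat p(s,E)\max_{a\text{ feasible}}\big[\hat r(s,E,a)+V(s')\big]+\Big(1-\sum_E\hat p(s,E)\Big)V(s).$$ Let $V$ be either an iterate $V_n$ of value iteration ($V_0=0$, $V_{n+1}=TV_n$), or a value function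 of the average reward problem, i.e. $g+V=TV$ on $\mathcal S$ for some $g\in\mathbb R$. The value of action $a$ is $\hat r(s,E,a)+V(s')$; an action is better if its value is larger, and optimal if it is feasible and its value is maximal among the feasible actions. Let $\tilde R_{W,D}(k)=(k+1)R_{W,D}(k+1)-kR_{W,D}(k)$ and let $k_{th}\in\mathbb N$ be such that, for all $k<W$, $R_{L,D}\ge\tilde R_{W,D}(k)$ if $k\ge k_{th}$ and $R_{L,D}<\tilde R_{W,D}(k)$ if $k<k_{th}$. **Lemma.** Suppose that a voice user arrives in a state $(i,j,k)\in\mathcal S$ with $i+j<C$. (i) If $k<k_{th}$ and $A_4$ is feasible ($j\ge1$, $k<W$), then $A_4$ is strictly better than $A_2$, and every optimal action is $A_4$ or $A_1$. (ii) If $k\ge k_{th}$, then $A_2$ is at least as good as $A_4$ whenever $A_4$ is feasible, and $A_2$ or $A_1$ is an optimal action. Moreover, a value function of the average reward problem exists, and there is a stationary deterministic policy that maximizes the long-run average reward of the discrete-time chain from every initial state, among all sequences of (possibly randomized) decision rules, and that upon a voice arrival in every state with $i+j<C$ chooses $A_4$ or $A_1$ if $k<k_{th}$ and $A_4$ is feasible,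 and $A_2$ or $A_1$ if $k\ge k_{th}$. -/

import Mathlib

open Filter Topology

namespace HetNet

/-- A system state: `i` voice users in LTE, `j` data users in LTE, `k` data users in WiFi. -/
@[ext]
structure State where
  i : ℕ
  j : ℕ
  k : ℕ

/-- The five types of events. -/
inductive Event
  | voiceArrival
  | dataArrival
  | voiceDepartureLTE
  | dataDepartureLTE
  | dataDepartureWiFi
  deriving DecidableEq

instance : Fintype Event where
  elems := {.voiceArrival, .dataArrival, .voiceDepartureLTE, .dataDepartureLTE, .dataDepartureWiFi}
  complete := by intro E; cases E <;> simp

/-- The five actions: `A1` block the arriving user, or do nothing at a departure; `A2` accept in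
LTE; `A3` accept the data user in WiFi; `A4` accept the voice user in LTE and offload one data user
from LTE to WiFi; `A5` move one data user to the network from which the departure occurred. -/
inductive Action
  | A1
  | A2
  | A3
  | A4
  | A5
  deriving DecidableEq

instance : Fintype Action where
  elems := {.A1, .A2, .A3, .A4, .A5}
  complete := by intro a; cases a <;> simp

/-- The state after event `E` under action `a`. Natural-number subtraction never truncates when `a`
is feasible; the last line is only reached for infeasible actions. -/
def next (s : State) : Event → Action → State
  | .voiceArrival, .A1 => s
  | .dataArrival, .A1 => s
  | .voiceDepartureLTE, .A1 => ⟨s.i - 1, s.j, s.k⟩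
  | .dataDepartureLTE, .A1 => ⟨s.i, s.j - 1, s.k⟩
  | .dataDepartureWiFi, .A1 => ⟨s.i, s.j, s.k - 1⟩
  | .voiceArrival, .A2 => ⟨s.i + 1, s.j, s.k⟩
  | .dataArrival, .A2 => ⟨s.i, s.j + 1, s.k⟩
  | .dataArrival, .A3 => ⟨s.i, s.j, s.k + 1⟩
  | .voiceArrival, .A4 => ⟨s.i + 1, s.j - 1, s.k + 1⟩
  | .voiceDepartureLTE, .A5 => ⟨s.i - 1, s.j + 1, s.k - 1⟩
  | .dataDepartureLTE, .A5 => ⟨s.i, s.j, s.k - 1⟩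
  | .dataDepartureWiFi, .A5 => ⟨s.i, s.j - 1, s.k⟩
  | _, _ => s

/-- Cost: one unit when a voice user is blocked, zero otherwise. -/
def cost : Event → Action → ℝ
  | .voiceArrival, .A1 => 1
  | _, _ => 0

/-- A (possibly randomized) decision rule: the probability of choosing each action in each state
under each event. -/
abbrev DecisionRule := State → Event → Action → ℝ

/-- The decision rule that chooses the action `φ s E` with probability one. -/
def pureRule (φ : State → Event → Action) : DecisionRule :=
  fun s E a => if a = φ s E then 1 else 0

/-- The parameters of the LTE-WiFi system. -/
structure Params where
  /-- number of resource blocks in LTE -/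
  C : ℕ
  /-- maximum number of WiFi users -/
  W : ℕ
  /-- arrival rates of voice and data users -/
  lamV : ℝ
  lamD : ℝ
  /-- service rates of voice and data users -/
  muV : ℝ
  muD : ℝ
  /-- bit rate of a voice user in LTE -/
  RLV : ℝ
  /-- bit rate of a data user in LTE -/
  RLD : ℝ
  /-- per-user throughput in WiFi as a function of the number of WiFi users -/
  RWD : ℕ → ℝ
  /-- Lagrange multiplier of voice blocking (zero for the unconstrained problem) -/
  β : ℝ
  /-- time step of the uniformization -/
  δ : ℝ
  C_pos : 0 < C
  lamV_pos : 0 < lamV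
  lamD_pos : 0 < lamD
  muV_pos : 0 < muV
  muD_pos : 0 < muD
  δ_pos : 0 < δ
  /-- the step does not exceed the expected time until the next event in any state -/
  δ_le : ∀ i j k : ℕ, i + j ≤ C → k ≤ W →
    δ * (lamV + lamD + i * muV + j * muD + k * muD) ≤ 1

namespace Params

/-- The state space. -/
def states (P : Params) : Set State := {s | s.i + s.j ≤ P.C ∧ s.k ≤ P.W}

/-- `P.Feasible s E a`: under event `E` in state `s`, action `a` is feasible. -/
def Feasible (P : Params) (s : State) : Event → Action → Prop
  | .voiceArrival, .A1 => s ∈ P.states ∧ s ≠ ⟨0, 0, 0⟩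
  | .voiceArrival, .A2 => s ∈ P.states ∧ s.i + s.j ≠ P.C
  | .voiceArrival, .A4 => s ∈ P.states ∧ ¬ (s.j = 0 ∨ s.k = P.W)
  | .dataArrival, .A1 => s ∈ P.states ∧ s.i + s.j = P.C ∧ s.k = P.W
  | .dataArrival, .A2 => s ∈ P.states ∧ s.i + s.j ≠ P.C
  | .dataArrival, .A3 => s ∈ P.states ∧ s.k ≠ P.W
  | .voiceDepartureLTE, .A1 => s ∈ P.states ∧ s.i ≠ 0
  | .voiceDepartureLTE, .A5 => s ∈ P.states ∧ ¬ (s.i = 0 ∨ s.k = 0)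
  | .dataDepartureLTE, .A1 => s ∈ P.states ∧ s.j ≠ 0
  | .dataDepartureLTE, .A5 => s ∈ P.states ∧ ¬ (s.j = 0 ∨ s.k = 0)
  | .dataDepartureWiFi, .A1 => s ∈ P.states ∧ s.k ≠ 0
  | .dataDepartureWiFi, .A5 => s ∈ P.states ∧ ¬ (s.j = 0 ∨ s.k = 0)
  | _, _ => False

/-- Total system throughput in a state. -/
noncomputable def throughput (P : Params) (s : State) : ℝ :=
  s.i * P.RLV + s.j * P.RLD + s.k * P.RWD s.k

/-- Increment of the total WiFi throughput when the number of WiFi users grows from `k` to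
`k + 1`. -/
noncomputable def wifiIncrement (P : Params) (k : ℕ) : ℝ :=
  ((k : ℝ) + 1) * P.RWD (k + 1) - k * P.RWD k

/-- `kth` is a threshold on the number of WiFi users: below it an additional data user adds strictly
more throughput in WiFi than in LTE, from it on at most as much. Only increments within the WiFi
capacity are constrained. -/
def IsThreshold (P : Params) (kth : ℕ) : Prop :=
  ∀ k < P.W, (kth ≤ k → P.wifiIncrement k ≤ P.RLD) ∧ (k < kth → P.RLD < P.wifiIncrement k)

/-- Probability of an event in one step of the uniformized chain. -/
noncomputable def prob (P : Params) (s : State) : Event → ℝ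
  | .voiceArrival => P.lamV * P.δ
  | .dataArrival => P.lamD * P.δ
  | .voiceDepartureLTE => s.i * P.muV * P.δ
  | .dataDepartureLTE => s.j * P.muD * P.δ
  | .dataDepartureWiFi => s.k * P.muD * P.δ

/-- Lagrangian reward: the throughput of the state reached, minus `β` if a voice user is
blocked. -/
noncomputable def reward (P : Params) (s : State) (E : Event) (a : Action) : ℝ :=
  P.throughput (next s E a) - P.β * cost E a

/-- The value of taking action `a` under event `E` in state `s`, when the continuation is valued
by `V`. -/
noncomputable def actionValue (P : Params) (V : State → ℝ) (s : State) (E : Event) (a : Action) :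
    ℝ :=
  P.reward s E a + V (next s E a)

/-- `a` is an optimal action under event `E` in state `s`, when the continuation is valued by
`V`: it attains the maximum in the dynamic programming equation. -/
def IsOptimalAction (P : Params) (V : State → ℝ) (s : State) (E : Event) (a : Action) : Prop :=
  P.Feasible s E a ∧ ∀ b, P.Feasible s E b → P.actionValue V s E b ≤ P.actionValue V s E a

/-- The right-hand side of the dynamic programming equation. The supremum runs over a finite set,
which for `s ∈ P.states` is empty only if the event has probability zero. -/
noncomputable def bellman (P : Params) (V : State → ℝ) (s : State) : ℝ :=
  ∑ E, P.prob s E * sSup ((fun a => P.actionValue V s E a) '' {a | P.Feasible s E a})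
    + (1 - ∑ E, P.prob s E) * V s

/-- Value iteration, started from zero. -/
noncomputable def valueIter (P : Params) : ℕ → State → ℝ
  | 0 => fun _ => 0
  | n + 1 => P.bellman (P.valueIter n)

/-- `V` is a (relative) value function with average reward `g` per step: the dynamic programming
equation of the average reward criterion holds on the state space. -/
def OptimalityEq (P : Params) (g : ℝ) (V : State → ℝ) : Prop :=
  ∀ s ∈ P.states, g + V s = P.bellman V s

/-- `d` chooses, in each state and under each event that can occur there, a feasible action,
possibly at random. -/
def IsDecisionRule (P : Params) (d : DecisionRule) : Prop :=
  ∀ s ∈ P.states, ∀ E, (∃ a, P.Feasible s E a) →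
    (∀ a, 0 ≤ d s E a) ∧ ∑ a, d s E a = 1 ∧ ∀ a, d s E a ≠ 0 → P.Feasible s E a

/-- Expected total reward over `n` steps of the uniformized chain started in `s`, under the policy
that uses the decision rule `π t` at step `t`. -/
noncomputable def totalReward (P : Params) : ℕ → (ℕ → DecisionRule) → State → ℝ
  | 0, _, _ => 0
  | n + 1, π, s =>
    ∑ E, P.prob s E * ∑ a, π 0 s E a *
        (P.reward s E a + P.totalReward n (fun t => π (t + 1)) (next s E a))
      + (1 - ∑ E, P.prob s E) * P.totalReward n (fun t => π (t + 1)) s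

/-- The stationary deterministic policy `φ` maximizes the long-run average reward among all
policies, that is, all sequences of (randomized) decision rules, from every initial state. -/
def IsAverageOptimal (P : Params) (φ : State → Event → Action) : Prop :=
  P.IsDecisionRule (pureRule φ) ∧
  ∃ g : ℝ,
    (∀ s ∈ P.states,
      Tendsto (fun n : ℕ => P.totalReward n (fun _ => pureRule φ) s / n) atTop (𝓝 g)) ∧
    ∀ π : ℕ → DecisionRule, (∀ t, P.IsDecisionRule (π t)) → ∀ s ∈ P.states, ∀ ε > 0,
      ∀ᶠ n : ℕ in atTop, P.totalReward n π s / n ≤ g + ε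

end Params

end HetNet

namespace HetNet

namespace Params

variable (P : Params)

/-! For voice arrivals, `A2` and `A4` lead to states that differ only in whether one data user sits
in LTE or in WiFi. So everything follows once the continuation `V` prefers WiFi below the threshold
and LTE from it on (`Unimodal`). Throughput has this preference by the choice of the threshold,
strictly below it, so `throughput + V` inherits it with strictness even if `V` has it only weakly.

The dynamic programming operator preserves `Unimodal`: two such states are coupled so that every
action in the worse one is matched by an action in the better one. This settles the iterates of
value iteration.

For value functions the inequality is passed to the limit. Under every policy the system empties
within `C + W` steps with probability bounded below, so the operator contracts the oscillation of
differences. Hence differences between states forget the starting function. The same contraction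
makes normalized value iteration Cauchy, which gives a solution of the average reward equation. A
policy greedy for such a solution is optimal by telescoping that equation, and ties can be broken in
favor of `A2`. -/

/-- Maximal value of a feasible action. -/
noncomputable def bestValue (V : State → ℝ) (s : State) (E : Event) : ℝ :=
  sSup ((fun a => P.actionValue V s E a) '' {a | P.Feasible s E a})

/-- Throughput of a state plus its continuation value. -/
noncomputable def gain (V : State → ℝ) (s : State) : ℝ := P.throughput s + V s

/-- Moving a data user from LTE to WiFi does not decrease `F` below the threshold `kth`, and does
not increase it from the threshold on. -/
def Unimodal (kth : ℕ) (F : State → ℝ) : Prop :=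
  ∀ i j k : ℕ, i + j + 1 ≤ P.C → k < P.W →
    (k < kth → F ⟨i, j + 1, k⟩ ≤ F ⟨i, j, k + 1⟩) ∧
    (kth ≤ k → F ⟨i, j, k + 1⟩ ≤ F ⟨i, j + 1, k⟩)

/-- On the state space, `U - V` ranges over an interval of length `r`. -/
def OscLE (U V : State → ℝ) (r : ℝ) : Prop :=
  ∃ m : ℝ, ∀ s ∈ P.states, m ≤ U s - V s ∧ U s - V s ≤ m + r

variable {P}

/-! ### Maximal action values, event probabilities and the finite state space. -/

theorem sum_event (F : Event → ℝ) :
    ∑ E, F E = F .voiceArrival + F .dataArrival + F .voiceDepartureLTE + F .dataDepartureLTE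
      + F .dataDepartureWiFi := by
  change ∑ E ∈ ({.voiceArrival, .dataArrival, .voiceDepartureLTE, .dataDepartureLTE,
    .dataDepartureWiFi} : Finset Event), F E = _
  rw [Finset.sum_insert (by decide), Finset.sum_insert (by decide), Finset.sum_insert (by decide),
    Finset.sum_insert (by decide), Finset.sum_singleton]
  ring

theorem bellman_eq (V : State → ℝ) (s : State) :
    P.bellman V s = ∑ E, P.prob s E * P.bestValue V s E + (1 - ∑ E, P.prob s E) * V s := rfl

theorem actionValue_le_bestValue {V : State → ℝ} {s : State} {E : Event} {a : Action}
    (h : P.Feasible s E a) : P.actionValue V s E a ≤ P.bestValue V s E :=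
  le_csSup ((Set.toFinite _).bddAbove) ⟨a, h, rfl⟩

theorem bestValue_le {V : State → ℝ} {s : State} {E : Event} {x : ℝ}
    (hne : ∃ a, P.Feasible s E a) (h : ∀ a, P.Feasible s E a → P.actionValue V s E a ≤ x) :
    P.bestValue V s E ≤ x := by
  obtain ⟨a, ha⟩ := hne
  refine csSup_le ⟨_, a, ha, rfl⟩ ?_
  rintro _ ⟨b, hb, rfl⟩
  exact h b hb

theorem bestValue_le_bestValue {U V : State → ℝ} {s t : State} {E : Event}
    (hne : ∃ a, P.Feasible s E a)
    (h : ∀ a, P.Feasible s E a → ∃ b, P.Feasible t E b ∧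
      P.actionValue U s E a ≤ P.actionValue V t E b) :
    P.bestValue U s E ≤ P.bestValue V t E :=
  bestValue_le hne fun a ha => by
    obtain ⟨b, hb, hab⟩ := h a ha
    exact hab.trans (actionValue_le_bestValue hb)

theorem exists_isOptimalAction (V : State → ℝ) {s : State} {E : Event}
    (hne : ∃ a, P.Feasible s E a) : ∃ a, P.IsOptimalAction V s E a := by
  obtain ⟨a, ha, hmax⟩ := Set.exists_max_image {a | P.Feasible s E a}
    (fun a => P.actionValue V s E a) (Set.toFinite _) hne
  exact ⟨a, ha, hmax⟩

theorem IsOptimalAction.actionValue_eq {V : State → ℝ} {s : State} {E : Event} {a : Action}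
    (h : P.IsOptimalAction V s E a) : P.actionValue V s E a = P.bestValue V s E :=
  le_antisymm (actionValue_le_bestValue h.1) (bestValue_le ⟨a, h.1⟩ h.2)

theorem prob_nonneg (s : State) (E : Event) : 0 ≤ P.prob s E := by
  have := P.lamV_pos.le
  have := P.lamD_pos.le
  have := P.muV_pos.le
  have := P.muD_pos.le
  have := P.δ_pos.le
  cases E <;> simp only [prob] <;> positivity

theorem sum_prob_le_one {s : State} (hs : s ∈ P.states) : 0 ≤ 1 - ∑ E, P.prob s E := by
  have := P.δ_le s.i s.j s.k hs.1 hs.2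
  simp only [sum_event, prob]
  linarith

/-- The supremum over an empty set of actions is a junk value; this lemma shows that it always
carries weight zero. In the empty state blocking a voice user is forbidden, and `C_pos` makes `A2`
feasible. -/
theorem prob_eq_zero_or_exists_feasible {s : State} (hs : s ∈ P.states) (E : Event) :
    P.prob s E = 0 ∨ ∃ a, P.Feasible s E a := by
  cases E with
  | voiceArrival =>
    right
    by_cases h : s = ⟨0, 0, 0⟩
    · refine ⟨.A2, hs, ?_⟩
      subst h
      exact P.C_pos.ne
    · exact ⟨.A1, hs, h⟩
  | dataArrival =>
    right
    by_cases h : s.i + s.j = P.C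
    · by_cases h' : s.k = P.W
      · exact ⟨.A1, hs, h, h'⟩
      · exact ⟨.A3, hs, h'⟩
    · exact ⟨.A2, hs, h⟩
  | voiceDepartureLTE =>
    by_cases h : s.i = 0
    · simp [prob, h]
    · exact .inr ⟨.A1, hs, h⟩
  | dataDepartureLTE =>
    by_cases h : s.j = 0
    · simp [prob, h]
    · exact .inr ⟨.A1, hs, h⟩
  | dataDepartureWiFi =>
    by_cases h : s.k = 0
    · simp [prob, h]
    · exact .inr ⟨.A1, hs, h⟩

theorem next_mem_states {s : State} {E : Event} {a : Action} (h : P.Feasible s E a) :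
    next s E a ∈ P.states := by
  cases E <;> cases a <;> simp only [Feasible, next, states, Set.mem_ofPred_eq] at h ⊢ <;> grind

theorem states_finite : P.states.Finite := by
  refine ((((Set.finite_Iic P.C).prod ((Set.finite_Iic P.C).prod (Set.finite_Iic P.W))).image
    fun x : ℕ × ℕ × ℕ => (⟨x.1, x.2.1, x.2.2⟩ : State))).subset ?_
  rintro ⟨i, j, k⟩ ⟨h1, h2⟩
  simp only at h1 h2
  refine ⟨(i, j, k), ⟨?_, ?_, ?_⟩, rfl⟩ <;> simp only [Set.mem_Iic] <;> omega

theorem zero_mem_states : (⟨0, 0, 0⟩ : State) ∈ P.states := by simp [states]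

theorem exists_abs_le (V : State → ℝ) : ∃ B, ∀ s ∈ P.states, |V s| ≤ B := by
  obtain ⟨B, hB⟩ := (P.states_finite.image fun s => |V s|).bddAbove
  exact ⟨B, fun s hs => hB ⟨s, hs, rfl⟩⟩

/-! ### Unimodality -/

theorem throughput_sub (i j k : ℕ) :
    P.throughput ⟨i, j, k + 1⟩ - P.throughput ⟨i, j + 1, k⟩ = P.wifiIncrement k - P.RLD := by
  simp only [throughput, wifiIncrement]
  push_cast
  ring

theorem Unimodal.gain {kth : ℕ} (hkth : P.IsThreshold kth) {V : State → ℝ}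
    (hV : P.Unimodal kth V) : P.Unimodal kth (P.gain V) := by
  intro i j k hij hk
  have h1 := hV i j k hij hk
  have h2 := hkth k hk
  have h3 := P.throughput_sub i j k
  simp only [Params.gain]
  exact ⟨fun h => by linarith [h1.1 h, h2.2 h], fun h => by linarith [h1.2 h, h2.1 h]⟩

theorem Unimodal.gain_lt {kth : ℕ} (hkth : P.IsThreshold kth) {V : State → ℝ}
    (hV : P.Unimodal kth V) {i j k : ℕ} (hij : i + j + 1 ≤ P.C) (hk : k < P.W) (h : k < kth) :
    P.gain V ⟨i, j + 1, k⟩ < P.gain V ⟨i, j, k + 1⟩ := by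
  have h1 := (hV i j k hij hk).1 h
  have h2 := (hkth k hk).2 h
  have h3 := P.throughput_sub i j k
  simp only [Params.gain]
  linarith

theorem actionValue_eq (V : State → ℝ) (s : State) (E : Event) (a : Action) :
    P.actionValue V s E a = P.gain V (next s E a) - P.β * cost E a := by
  simp only [actionValue, reward, gain]
  ring

/-- Comparison of the dynamic programming operator in two states with the same numbers of voice and
data users. -/
theorem bellman_le_bellman {V : State → ℝ} {s t : State} (hs : s ∈ P.states) (ht : t ∈ P.states)
    (hi : s.i = t.i) (hjk : s.j + s.k = t.j + t.k) (hV : V s ≤ V t)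
    (hdom : ∀ E, E ≠ .dataDepartureLTE → E ≠ .dataDepartureWiFi → ∀ a, P.Feasible s E a →
      ∃ b, P.Feasible t E b ∧ P.actionValue V s E a ≤ P.actionValue V t E b)
    (X : ℝ) (hX : ∀ E, E = .dataDepartureLTE ∨ E = .dataDepartureWiFi →
      (∀ a, P.Feasible s E a → P.actionValue V s E a ≤ X) ∧
      ((∃ a, P.Feasible t E a) → ∃ b, P.Feasible t E b ∧ X ≤ P.actionValue V t E b)) :
    P.bellman V s ≤ P.bellman V t := by
  have hjk' : (s.j : ℝ) + s.k = t.j + t.k := by exact_mod_cast hjk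
  have hsum : ∑ E, P.prob s E = ∑ E, P.prob t E := by
    simp only [sum_event, prob, hi]
    linear_combination P.muD * P.δ * hjk'
  have hle : ∀ E, E ≠ .dataDepartureLTE → E ≠ .dataDepartureWiFi →
      P.prob s E * P.bestValue V s E ≤ P.prob t E * P.bestValue V t E := by
    intro E h1 h2
    have hp : P.prob s E = P.prob t E := by cases E <;> simp_all [prob]
    rw [← hp]
    rcases P.prob_eq_zero_or_exists_feasible hs E with h | h
    · simp [h]
    · exact mul_le_mul_of_nonneg_left (bestValue_le_bestValue h (hdom E h1 h2)) (prob_nonneg s E)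
  have hsX : ∀ E, E = .dataDepartureLTE ∨ E = .dataDepartureWiFi →
      P.prob s E * P.bestValue V s E ≤ P.prob s E * X := by
    intro E hE
    rcases P.prob_eq_zero_or_exists_feasible hs E with h | h
    · simp [h]
    · exact mul_le_mul_of_nonneg_left (bestValue_le h (hX E hE).1) (prob_nonneg s E)
  have htX : ∀ E, E = .dataDepartureLTE ∨ E = .dataDepartureWiFi →
      P.prob t E * X ≤ P.prob t E * P.bestValue V t E := by
    intro E hE
    rcases P.prob_eq_zero_or_exists_feasible ht E with h | h
    · simp [h]
    · obtain ⟨b, hb, hXb⟩ := (hX E hE).2 h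
      exact mul_le_mul_of_nonneg_left (hXb.trans (actionValue_le_bestValue hb)) (prob_nonneg t E)
  -- The two states split the data departure rate differently between the networks, so these events
  -- are not compared one by one. Only the total rate agrees, and the pivot `X` separates the values
  -- in `s` from those in `t`.
  have hdep : P.prob s .dataDepartureLTE * X + P.prob s .dataDepartureWiFi * X
      = P.prob t .dataDepartureLTE * X + P.prob t .dataDepartureWiFi * X := by
    simp only [prob]
    linear_combination P.muD * P.δ * X * hjk'
  have h1 := hle .voiceArrival (by decide) (by decide)
  have h2 := hle .dataArrival (by decide) (by decide)
  have h3 := hle .voiceDepartureLTE (by decide) (by decide)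
  have h4 := hsX .dataDepartureLTE (by decide)
  have h5 := hsX .dataDepartureWiFi (by decide)
  have h6 := htX .dataDepartureLTE (by decide)
  have h7 := htX .dataDepartureWiFi (by decide)
  have h8 := mul_le_mul_of_nonneg_left hV (P.sum_prob_le_one hs)
  rw [bellman_eq, bellman_eq, ← hsum, sum_event fun E => P.prob s E * P.bestValue V s E,
    sum_event fun E => P.prob t E * P.bestValue V t E]
  linarith

/-- Matched actions lead either to the same state or to a pair of the same kind whose WiFi index is
`k` or `k - 1`, so the pair stays below the threshold. For data departures the pivot is the gain of
`(i, j, k)`, which `A5` makes reachable when the departure is from LTE. -/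
theorem Unimodal.bellman_le_of_lt {kth : ℕ} (hkth : P.IsThreshold kth) {V : State → ℝ}
    (hV : P.Unimodal kth V) {i j k : ℕ} (hij : i + j + 1 ≤ P.C) (hk : k < P.W) (hlt : k < kth) :
    P.bellman V ⟨i, j + 1, k⟩ ≤ P.bellman V ⟨i, j, k + 1⟩ := by
  have hG : ∀ i j k : ℕ, i + j + 1 ≤ P.C → k < P.W → k < kth →
      P.gain V ⟨i, j + 1, k⟩ ≤ P.gain V ⟨i, j, k + 1⟩ :=
    fun i j k h1 h2 => (hV.gain hkth i j k h1 h2).1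
  have hs : (⟨i, j + 1, k⟩ : State) ∈ P.states := ⟨by simp only; omega, hk.le⟩
  have ht : (⟨i, j, k + 1⟩ : State) ∈ P.states := ⟨by simp only; omega, hk⟩
  refine bellman_le_bellman hs ht rfl (by simp only; omega) ((hV i j k hij hk).1 hlt) ?_
    (P.gain V ⟨i, j, k⟩) ?_
  · intro E h1 h2 a ha
    simp only [actionValue_eq]
    cases E <;> cases a <;> simp only [Feasible, hs, true_and] at ha <;> try contradiction
    · exact ⟨.A1, ⟨ht, by simp⟩, by simpa [next] using hG i j k hij hk hlt⟩
    · exact ⟨.A2, ⟨ht, by simp only; omega⟩, by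
        simpa [next, cost] using hG (i + 1) j k (by omega) hk hlt⟩
    · exact ⟨.A2, ⟨ht, by simp only; omega⟩, by simp [next, cost]⟩
    -- Blocking a data user requires a full WiFi, which `hk` excludes.
    · omega
    · exact ⟨.A2, ⟨ht, by simp only; omega⟩, by
        simpa [next, cost] using hG i (j + 1) k (by omega) hk hlt⟩
    · exact ⟨.A2, ⟨ht, by simp only; omega⟩, by simp [next, cost]⟩
    · exact ⟨.A1, ⟨ht, ha⟩, by simpa [next, cost] using hG (i - 1) j k (by omega) hk hlt⟩
    · exact ⟨.A5, ⟨ht, by simp only; omega⟩, by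
        obtain ⟨k, rfl⟩ : ∃ l, k = l + 1 := ⟨k - 1, by omega⟩
        simpa [next, cost] using hG (i - 1) (j + 1) k (by omega) (by omega) (by omega)⟩
  · have hk1 : k ≠ 0 → P.gain V ⟨i, j + 1, k - 1⟩ ≤ P.gain V ⟨i, j, k⟩ := by
      intro h
      obtain ⟨k, rfl⟩ : ∃ l, k = l + 1 := ⟨k - 1, by omega⟩
      exact hG i j k hij (by omega) (by omega)
    rintro E hE
    simp only [actionValue_eq]
    refine ⟨fun a ha => ?_, fun hne => ?_⟩
    · cases E <;> cases a <;> simp only [Feasible, hs, true_and] at ha <;>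
        try first | contradiction | simp at hE
      · simp [next, cost]
      · simpa [next, cost] using hk1 (by omega)
      · simpa [next, cost] using hk1 (by omega)
      · simp [next, cost]
    · rcases hE with rfl | rfl
      · refine ⟨.A5, ⟨ht, ?_⟩, by simp [next, cost]⟩
        obtain ⟨a, ha⟩ := hne
        cases a <;> simp only [Feasible, ht, true_and] at ha <;> simp only <;> omega
      · exact ⟨.A1, ⟨ht, by simp⟩, by simp [next, cost]⟩

/-- The mirror image: the WiFi index of a matched pair is `k` or `k + 1`, so the pair stays at or
above the threshold. Here `A5` reaches the pivot after a departure from WiFi. -/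
theorem Unimodal.bellman_le_of_ge {kth : ℕ} (hkth : P.IsThreshold kth) {V : State → ℝ}
    (hV : P.Unimodal kth V) {i j k : ℕ} (hij : i + j + 1 ≤ P.C) (hk : k < P.W) (hle : kth ≤ k) :
    P.bellman V ⟨i, j, k + 1⟩ ≤ P.bellman V ⟨i, j + 1, k⟩ := by
  have hG : ∀ i j k : ℕ, i + j + 1 ≤ P.C → k < P.W → kth ≤ k →
      P.gain V ⟨i, j, k + 1⟩ ≤ P.gain V ⟨i, j + 1, k⟩ :=
    fun i j k h1 h2 => (hV.gain hkth i j k h1 h2).2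
  have hs : (⟨i, j + 1, k⟩ : State) ∈ P.states := ⟨by simp only; omega, hk.le⟩
  have ht : (⟨i, j, k + 1⟩ : State) ∈ P.states := ⟨by simp only; omega, hk⟩
  refine bellman_le_bellman ht hs rfl (by simp only; omega) ((hV i j k hij hk).2 hle) ?_
    (P.gain V ⟨i, j, k⟩) ?_
  · intro E h1 h2 a ha
    simp only [actionValue_eq]
    cases E <;> cases a <;> simp only [Feasible, ht, true_and] at ha <;> try contradiction
    · exact ⟨.A1, ⟨hs, by simp⟩, by simpa [next] using hG i j k hij hk hle⟩
    · exact ⟨.A4, ⟨hs, by simp only; omega⟩, by simp [next, cost]⟩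
    · exact ⟨.A4, ⟨hs, by simp only; omega⟩, by
        obtain ⟨j, rfl⟩ : ∃ l, j = l + 1 := ⟨j - 1, by omega⟩
        simpa [next, cost] using hG (i + 1) j (k + 1) (by omega) (by omega) (by omega)⟩
    · omega
    · exact ⟨.A3, ⟨hs, by simp only; omega⟩, by simp [next, cost]⟩
    · exact ⟨.A3, ⟨hs, by simp only; omega⟩, by
        simpa [next, cost] using hG i j (k + 1) (by omega) (by omega) (by omega)⟩
    · exact ⟨.A1, ⟨hs, ha⟩, by simpa [next, cost] using hG (i - 1) j k (by omega) hk hle⟩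
    · exact ⟨.A1, ⟨hs, by simp only; omega⟩, by simp [next, cost]⟩
  · have hj1 : j ≠ 0 → P.gain V ⟨i, j - 1, k + 1⟩ ≤ P.gain V ⟨i, j, k⟩ := by
      intro h
      obtain ⟨j, rfl⟩ : ∃ l, j = l + 1 := ⟨j - 1, by omega⟩
      exact hG i j k (by omega) hk hle
    rintro E hE
    simp only [actionValue_eq]
    refine ⟨fun a ha => ?_, fun hne => ?_⟩
    · cases E <;> cases a <;> simp only [Feasible, ht, true_and] at ha <;>
        try first | contradiction | simp at hE
      · simpa [next, cost] using hj1 (by omega)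
      · simp [next, cost]
      · simp [next, cost]
      · simpa [next, cost] using hj1 (by omega)
    · rcases hE with rfl | rfl
      · exact ⟨.A1, ⟨hs, by simp⟩, by simp [next, cost]⟩
      · refine ⟨.A5, ⟨hs, ?_⟩, by simp [next, cost]⟩
        obtain ⟨a, ha⟩ := hne
        cases a <;> simp only [Feasible, hs, true_and] at ha <;> simp only <;> omega

theorem Unimodal.bellman {kth : ℕ} (hkth : P.IsThreshold kth) {V : State → ℝ}
    (hV : P.Unimodal kth V) : P.Unimodal kth (P.bellman V) :=
  fun _ _ _ hij hk => ⟨hV.bellman_le_of_lt hkth hij hk, hV.bellman_le_of_ge hkth hij hk⟩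

theorem unimodal_valueIter {kth : ℕ} (hkth : P.IsThreshold kth) (n : ℕ) :
    P.Unimodal kth (P.valueIter n) := by
  induction n with
  | zero => exact fun _ _ _ _ _ => ⟨fun _ => le_rfl, fun _ => le_rfl⟩
  | succ n ih => exact ih.bellman hkth

/-! ### Contraction of the oscillation -/

/-- Event probabilities do not depend on the action, so offsets average over events. Letting them
differ between events is what later yields a strict gain at departures. -/
theorem bellman_le_bellman_add {U V : State → ℝ} {s : State} (hs : s ∈ P.states)
    (c : Event → ℝ) (c₀ : ℝ)
    (h : ∀ E a, P.Feasible s E a → V (next s E a) ≤ U (next s E a) + c E)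
    (h₀ : V s ≤ U s + c₀) :
    P.bellman V s ≤ P.bellman U s + (∑ E, P.prob s E * c E + (1 - ∑ E, P.prob s E) * c₀) := by
  have h1 : ∑ E, P.prob s E * P.bestValue V s E
      ≤ ∑ E, P.prob s E * P.bestValue U s E + ∑ E, P.prob s E * c E := by
    rw [← Finset.sum_add_distrib]
    refine Finset.sum_le_sum fun E _ => ?_
    rcases P.prob_eq_zero_or_exists_feasible hs E with h' | h'
    · simp [h']
    · rw [← mul_add]
      refine mul_le_mul_of_nonneg_left (bestValue_le h' fun a ha => ?_) (prob_nonneg s E)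
      have h2 := actionValue_le_bestValue (V := U) ha
      have h3 := h E a ha
      simp only [actionValue] at h2 ⊢
      linarith
  have h2 := mul_le_mul_of_nonneg_left h₀ (P.sum_prob_le_one hs)
  rw [bellman_eq, bellman_eq]
  linarith

theorem bellman_le_bellman_add_const {U V : State → ℝ} {c : ℝ}
    (h : ∀ s ∈ P.states, V s ≤ U s + c) {s : State} (hs : s ∈ P.states) :
    P.bellman V s ≤ P.bellman U s + c := by
  have := P.bellman_le_bellman_add hs (fun _ => c) c (fun E a ha => h _ (next_mem_states ha))
    (h s hs)
  rw [← Finset.sum_mul] at this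
  linarith

theorem iterate_le_iterate_add_const {U V : State → ℝ} {c : ℝ}
    (h : ∀ s ∈ P.states, V s ≤ U s + c) (n : ℕ) :
    ∀ s ∈ P.states, P.bellman^[n] V s ≤ P.bellman^[n] U s + c := by
  induction n with
  | zero => exact h
  | succ n ih =>
    intro s hs
    simp only [Function.iterate_succ_apply']
    exact bellman_le_bellman_add_const ih hs

variable (P) in
/-- Lower bound for the probability that a user departs if there is one, and that nothing happens
in the empty state. -/
noncomputable def minProb : ℝ := min (min (P.muV * P.δ) (P.muD * P.δ)) (1 - (P.lamV + P.lamD) * P.δ)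

theorem minProb_pos : 0 < P.minProb := by
  -- Since `C ≥ 1`, a state with one voice user exists; its departure probability is the slack left
  -- over in the empty state.
  have h := P.δ_le 1 0 0 (by have := P.C_pos; omega) (Nat.zero_le _)
  have h1 := mul_pos P.muV_pos P.δ_pos
  refine lt_min (lt_min h1 (mul_pos P.muD_pos P.δ_pos)) ?_
  push_cast at h
  linarith

theorem minProb_le_one : P.minProb ≤ 1 := by
  refine (min_le_right _ _).trans ?_
  have := mul_pos (add_pos P.lamV_pos P.lamD_pos) P.δ_pos
  linarith

theorem minProb_le_departure {s : State} (hs : s ≠ ⟨0, 0, 0⟩) :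
    P.minProb ≤ P.prob s .voiceDepartureLTE + P.prob s .dataDepartureLTE
      + P.prob s .dataDepartureWiFi := by
  have hV : P.minProb ≤ P.muV * P.δ := (min_le_left _ _).trans (min_le_left _ _)
  have hD : P.minProb ≤ P.muD * P.δ := (min_le_left _ _).trans (min_le_right _ _)
  have h1 := P.prob_nonneg s .voiceDepartureLTE
  have h2 := P.prob_nonneg s .dataDepartureLTE
  have h3 := P.prob_nonneg s .dataDepartureWiFi
  have hμV := mul_pos P.muV_pos P.δ_pos
  have hμD := mul_pos P.muD_pos P.δ_pos
  have key : ∀ (n : ℕ) (x : ℝ), 0 < x → n ≠ 0 → x ≤ n * x := fun n x hx hn =>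
    le_mul_of_one_le_left hx.le (by exact_mod_cast Nat.one_le_iff_ne_zero.2 hn)
  simp only [prob, mul_assoc] at *
  by_cases hi : s.i = 0
  · by_cases hj : s.j = 0
    · have hk : s.k ≠ 0 := fun hk => hs (State.ext hi hj hk)
      linarith [key _ _ hμD hk]
    · linarith [key _ _ hμD hj]
  · linarith [key _ _ hμV hi]

/-- After `n` steps, the states with at most `n` users feel the value of the empty state. -/
theorem iterate_le_iterate_add {U V : State → ℝ} {M : ℝ}
    (h : ∀ s ∈ P.states, V s ≤ U s + M) (n : ℕ) :
    ∀ s ∈ P.states, s.i + s.j + s.k ≤ n → P.bellman^[n] V s ≤ P.bellman^[n] U s +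
      (M - P.minProb ^ n * (M - (V ⟨0, 0, 0⟩ - U ⟨0, 0, 0⟩))) := by
  have hq : 0 ≤ M - (V ⟨0, 0, 0⟩ - U ⟨0, 0, 0⟩) := by linarith [h _ zero_mem_states]
  set q := M - (V ⟨0, 0, 0⟩ - U ⟨0, 0, 0⟩) with hqdef
  have hε := P.minProb_pos
  induction n with
  | zero =>
    intro s hs h0
    obtain rfl : s = ⟨0, 0, 0⟩ := State.ext (by simp; omega) (by simp; omega) (by simp; omega)
    simp [hqdef]
  | succ n ih =>
    intro s hs hn
    simp only [Function.iterate_succ_apply']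
    have hM := P.iterate_le_iterate_add_const h n
    have hr : 0 ≤ P.minProb ^ n * q := mul_nonneg (pow_nonneg hε.le n) hq
    -- The empty state persists with probability at least `minProb`; from any other state a
    -- departure has at least that probability and removes one user whichever action is taken.
    by_cases hs0 : s = ⟨0, 0, 0⟩
    · refine (P.bellman_le_bellman_add hs (fun _ => M) (M - P.minProb ^ n * q)
        (fun E a ha => hM _ (next_mem_states ha)) (ih s hs (by subst hs0; simp))).trans ?_
      have hp : P.minProb ≤ 1 - ∑ E, P.prob s E := by
        refine (min_le_right _ _).trans (le_of_eq ?_)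
        subst hs0
        simp [sum_event, prob]
        ring
      have := mul_le_mul_of_nonneg_right hp hr
      rw [← Finset.sum_mul, pow_succ]
      linarith
    · set c : Event → ℝ := fun E => match E with
        | .voiceArrival => M
        | .dataArrival => M
        | _ => M - P.minProb ^ n * q with hc
      refine (P.bellman_le_bellman_add hs c M (fun E a ha => ?_) (hM s hs)).trans ?_
      · have hmem := next_mem_states ha
        have hlt : E ≠ .voiceArrival → E ≠ .dataArrival →
            (next s E a).i + (next s E a).j + (next s E a).k ≤ n := by
          cases E <;> cases a <;> simp only [Feasible, next] at ha ⊢ <;>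
            first | contradiction | (intros; omega) | (intro h1 h2; simp at h1 h2)
        cases E
        · exact hM _ hmem
        · exact hM _ hmem
        all_goals exact ih _ hmem (hlt (by decide) (by decide))
      · have := mul_le_mul_of_nonneg_right (P.minProb_le_departure hs0) hr
        simp only [sum_event, hc, pow_succ]
        linarith

variable (P) in
/-- Contraction factor of the oscillation over `C + W` steps. -/
noncomputable def contr : ℝ := 1 - P.minProb ^ (P.C + P.W)

theorem contr_nonneg : 0 ≤ P.contr :=
  sub_nonneg.2 (pow_le_one₀ P.minProb_pos.le P.minProb_le_one)

theorem contr_lt_one : P.contr < 1 := sub_lt_self _ (pow_pos P.minProb_pos _)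

theorem OscLE.iterate {U V : State → ℝ} {r : ℝ} (h : P.OscLE U V r) :
    P.OscLE (P.bellman^[P.C + P.W] U) (P.bellman^[P.C + P.W] V) (P.contr * r) := by
  obtain ⟨m, hm⟩ := h
  have hN : ∀ s ∈ P.states, s.i + s.j + s.k ≤ P.C + P.W := fun s hs => add_le_add hs.1 hs.2
  -- No state has more than `C + W` users. Each end of the interval moves toward the difference at
  -- the empty state by a fixed fraction of its distance; the two distances add up to `r`.
  refine ⟨m + P.minProb ^ (P.C + P.W) * (U ⟨0, 0, 0⟩ - V ⟨0, 0, 0⟩ - m), fun s hs => ?_⟩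
  have h1 := P.iterate_le_iterate_add (U := V) (V := U) (M := m + r)
    (fun s hs => by linarith [(hm s hs).2]) (P.C + P.W) s hs (hN s hs)
  have h2 := P.iterate_le_iterate_add (U := U) (V := V) (M := -m)
    (fun s hs => by linarith [(hm s hs).1]) (P.C + P.W) s hs (hN s hs)
  constructor
  · linarith
  · simp only [contr]
    linarith

theorem OscLE.iterate_mul {U V : State → ℝ} {r : ℝ} (h : P.OscLE U V r) (m : ℕ) :
    P.OscLE (P.bellman^[(P.C + P.W) * m] U) (P.bellman^[(P.C + P.W) * m] V) (P.contr ^ m * r) := by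
  induction m with
  | zero => simpa using h
  | succ m ih =>
    have := ih.iterate
    rwa [← Function.iterate_add_apply, ← Function.iterate_add_apply, Nat.add_comm, ← Nat.mul_succ,
      ← mul_assoc, ← pow_succ'] at this

theorem OscLE.abs_sub_le {U V : State → ℝ} {r : ℝ} (h : P.OscLE U V r) {s t : State}
    (hs : s ∈ P.states) (ht : t ∈ P.states) : |(U s - U t) - (V s - V t)| ≤ r := by
  obtain ⟨m, hm⟩ := h
  have := hm s hs
  have := hm t ht
  rw [abs_le]
  constructor <;> linarith

theorem exists_oscLE (U V : State → ℝ) : ∃ r, P.OscLE U V r := by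
  obtain ⟨B, hB⟩ := P.exists_abs_le fun s => U s - V s
  refine ⟨2 * B, -B, fun s hs => ?_⟩
  have := abs_le.1 (hB s hs)
  constructor <;> linarith

theorem tendsto_iterate_sub (U V : State → ℝ) {s t : State} (hs : s ∈ P.states)
    (ht : t ∈ P.states) :
    Tendsto (fun m : ℕ =>
      (P.bellman^[(P.C + P.W) * m] U s - P.bellman^[(P.C + P.W) * m] U t)
        - (P.bellman^[(P.C + P.W) * m] V s - P.bellman^[(P.C + P.W) * m] V t)) atTop (𝓝 0) := by
  obtain ⟨r, hr⟩ := P.exists_oscLE U V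
  have h0 : Tendsto (fun m : ℕ => P.contr ^ m * r) atTop (𝓝 0) := by
    simpa using (tendsto_pow_atTop_nhds_zero_of_lt_one P.contr_nonneg P.contr_lt_one).mul_const r
  exact squeeze_zero_norm (fun m => (hr.iterate_mul m).abs_sub_le hs ht) h0

theorem valueIter_eq_iterate (n : ℕ) : P.valueIter n = P.bellman^[n] (fun _ => 0) := by
  induction n with
  | zero => rfl
  | succ n ih => rw [Function.iterate_succ_apply', ← ih]; rfl

theorem bellman_congr {U V : State → ℝ} {c : ℝ} (h : ∀ s ∈ P.states, V s = U s + c) {s : State}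
    (hs : s ∈ P.states) : P.bellman V s = P.bellman U s + c := by
  have h1 := bellman_le_bellman_add_const (fun s hs => (h s hs).le) hs
  have h2 := bellman_le_bellman_add_const (U := V) (V := U) (c := -c)
    (fun s hs => by linarith [h s hs]) hs
  linarith

theorem OptimalityEq.iterate {g : ℝ} {V : State → ℝ} (h : P.OptimalityEq g V) (n : ℕ) :
    ∀ s ∈ P.states, P.bellman^[n] V s = V s + n * g := by
  induction n with
  | zero => simp
  | succ n ih =>
    intro s hs
    rw [Function.iterate_succ_apply', bellman_congr ih hs, ← h s hs]
    push_cast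
    ring

/-- Iterating on `V` only adds constants, so `V s - V t` is the limit of the corresponding
differences of value iteration along multiples of `C + W`, and weak inequalities survive. -/
theorem OptimalityEq.unimodal {kth : ℕ} (hkth : P.IsThreshold kth) {g : ℝ} {V : State → ℝ}
    (h : P.OptimalityEq g V) : P.Unimodal kth V := by
  have key : ∀ s ∈ P.states, ∀ t ∈ P.states,
      (∀ n, P.valueIter n s ≤ P.valueIter n t) → V s ≤ V t := by
    intro s hs t ht hle
    have hlim := P.tendsto_iterate_sub V (fun _ => 0) hs ht
    refine sub_nonpos.1 (le_of_tendsto_of_tendsto tendsto_const_nhds hlim ?_)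
    filter_upwards with m
    have := hle ((P.C + P.W) * m)
    rw [valueIter_eq_iterate] at this
    rw [h.iterate _ s hs, h.iterate _ t ht]
    linarith
  intro i j k hij hk
  have hs : (⟨i, j + 1, k⟩ : State) ∈ P.states := ⟨by simp only; omega, hk.le⟩
  have ht : (⟨i, j, k + 1⟩ : State) ∈ P.states := ⟨by simp only; omega, hk⟩
  exact ⟨fun hlt => key _ hs _ ht fun n => (unimodal_valueIter hkth n i j k hij hk).1 hlt,
    fun hle => key _ ht _ hs fun n => (unimodal_valueIter hkth n i j k hij hk).2 hle⟩

/-! ### Existence of a value function -/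

theorem tendsto_bellman {x : ℕ → State → ℝ} {V : State → ℝ}
    (h : ∀ s ∈ P.states, Tendsto (fun m => x m s) atTop (𝓝 (V s))) {s : State}
    (hs : s ∈ P.states) : Tendsto (fun m => P.bellman (x m) s) atTop (𝓝 (P.bellman V s)) := by
  rw [Metric.tendsto_atTop']
  intro ε hε
  have hev : ∀ᶠ m in atTop, ∀ t ∈ P.states, |x m t - V t| < ε / 2 :=
    (P.states_finite.eventually_all).2 fun t ht => by
      simpa [Real.dist_eq] using Metric.tendsto_nhds.1 (h t ht) (ε / 2) (by positivity)
  obtain ⟨N, hN⟩ := eventually_atTop.1 hev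
  refine ⟨N, fun m hm => ?_⟩
  have hm := hN m hm.le
  have h1 := bellman_le_bellman_add_const (U := V) (V := x m) (c := ε / 2)
    (fun t ht => by linarith [abs_lt.1 (hm t ht)]) hs
  have h2 := bellman_le_bellman_add_const (U := x m) (V := V) (c := ε / 2)
    (fun t ht => by linarith [abs_lt.1 (hm t ht)]) hs
  rw [Real.dist_eq, abs_lt]
  constructor <;> linarith

/-- Value iteration along multiples of `C + W`, normalized at the empty state, converges
geometrically. Its one-step increments become independent of the state, because iterates started
from `Z` and from `P.bellman Z` have asymptotically equal differences. -/
theorem exists_optimalityEq : ∃ g V, P.OptimalityEq g V := by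
  set N := P.C + P.W
  set z : State := ⟨0, 0, 0⟩
  have hz : z ∈ P.states := zero_mem_states
  set Z : State → ℝ := fun _ => 0
  set x : ℕ → State → ℝ := fun m s => P.bellman^[N * m] Z s - P.bellman^[N * m] Z z with hx
  obtain ⟨r, hr⟩ := P.exists_oscLE (P.bellman^[N] Z) Z
  have hlim : ∀ s, ∃ l, s ∈ P.states → Tendsto (fun m => x m s) atTop (𝓝 l) := by
    intro s
    by_cases hs : s ∈ P.states
    · have hc : CauchySeq fun m => x m s := by
        refine cauchySeq_of_le_geometric P.contr r P.contr_lt_one fun m => ?_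
        have := (hr.iterate_mul m).abs_sub_le hs hz
        rw [← Function.iterate_add_apply, ← Nat.mul_succ] at this
        rw [dist_comm, Real.dist_eq, mul_comm r]
        exact this
      obtain ⟨l, hl⟩ := cauchySeq_tendsto_of_complete hc
      exact ⟨l, fun _ => hl⟩
    · exact ⟨0, fun h => absurd h hs⟩
  choose V hV using hlim
  have hstep : ∀ m, ∀ s ∈ P.states, P.bellman (x m) s - x m s
      = P.bellman^[N * m] (P.bellman Z) s - P.bellman^[N * m] Z s := by
    intro m s hs
    have h1 := P.bellman_congr (U := P.bellman^[N * m] Z) (V := x m)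
      (c := -P.bellman^[N * m] Z z) (fun s _ => by simp only [hx]; ring) hs
    rw [h1, ← Function.iterate_succ_apply, Function.iterate_succ_apply']
    simp only [hx]
    ring
  refine ⟨P.bellman V z - V z, V, fun s hs => ?_⟩
  have h1 := ((tendsto_bellman hV hs).sub (hV s hs)).sub ((tendsto_bellman hV hz).sub (hV z hz))
  have h2 := P.tendsto_iterate_sub (P.bellman Z) Z hs hz
  have h3 := tendsto_nhds_unique h1 (h2.congr fun m => by
    rw [hstep m s hs, hstep m z hz]; ring)
  linarith

/-! ### Optimal actions and policies -/

theorem voiceArrival_lt {kth : ℕ} (hkth : P.IsThreshold kth) {V : State → ℝ}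
    (hV : P.Unimodal kth V) {i j k : ℕ} (hij : i + j < P.C) (hk : k ≤ P.W) (hlt : k < kth)
    (hf : P.Feasible ⟨i, j, k⟩ .voiceArrival .A4) :
    P.actionValue V ⟨i, j, k⟩ .voiceArrival .A2
      < P.actionValue V ⟨i, j, k⟩ .voiceArrival .A4 := by
  have hf' := hf.2
  simp only at hf'
  obtain ⟨j, rfl⟩ : ∃ l, j = l + 1 := ⟨j - 1, by omega⟩
  simpa [actionValue_eq, next, cost] using
    hV.gain_lt hkth (i := i + 1) (j := j) (k := k) (by omega) (by omega) hlt

theorem voiceArrival_le {kth : ℕ} (hkth : P.IsThreshold kth) {V : State → ℝ}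
    (hV : P.Unimodal kth V) {i j k : ℕ} (hij : i + j < P.C) (hk : k ≤ P.W) (hle : kth ≤ k)
    (hf : P.Feasible ⟨i, j, k⟩ .voiceArrival .A4) :
    P.actionValue V ⟨i, j, k⟩ .voiceArrival .A4
      ≤ P.actionValue V ⟨i, j, k⟩ .voiceArrival .A2 := by
  have hf' := hf.2
  simp only at hf'
  obtain ⟨j, rfl⟩ : ∃ l, j = l + 1 := ⟨j - 1, by omega⟩
  simpa [actionValue_eq, next, cost] using
    (hV.gain hkth (i + 1) j k (by omega) (by omega)).2 hle

theorem eq_of_isOptimalAction {kth : ℕ} (hkth : P.IsThreshold kth) {V : State → ℝ}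
    (hV : P.Unimodal kth V) {i j k : ℕ} (hij : i + j < P.C) (hk : k ≤ P.W) (hlt : k < kth)
    (hf : P.Feasible ⟨i, j, k⟩ .voiceArrival .A4) {a : Action}
    (ha : P.IsOptimalAction V ⟨i, j, k⟩ .voiceArrival a) : a = .A4 ∨ a = .A1 := by
  cases a with
  | A1 => exact .inr rfl
  | A4 => exact .inl rfl
  | A2 => exact absurd (ha.2 _ hf) (not_le.2 (voiceArrival_lt hkth hV hij hk hlt hf))
  | A3 => exact ha.1.elim
  | A5 => exact ha.1.elim

/-- The comparison is only weak here, so `A4` may be optimal too; whenever it is, `A2` ties with it.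
-/
theorem exists_isOptimalAction_eq {kth : ℕ} (hkth : P.IsThreshold kth) {V : State → ℝ}
    (hV : P.Unimodal kth V) {i j k : ℕ} (hij : i + j < P.C) (hk : k ≤ P.W) (hle : kth ≤ k) :
    ∃ a, P.IsOptimalAction V ⟨i, j, k⟩ .voiceArrival a ∧ (a = .A2 ∨ a = .A1) := by
  have h2 : P.Feasible ⟨i, j, k⟩ .voiceArrival .A2 := ⟨⟨hij.le, hk⟩, hij.ne⟩
  obtain ⟨a, ha⟩ := P.exists_isOptimalAction V ⟨_, h2⟩
  cases a with
  | A1 => exact ⟨_, ha, .inr rfl⟩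
  | A2 => exact ⟨_, ha, .inl rfl⟩
  | A4 =>
    exact ⟨.A2, ⟨h2, fun b hb => (ha.2 b hb).trans (voiceArrival_le hkth hV hij hk hle ha.1)⟩,
      .inl rfl⟩
  | A3 => exact ha.1.elim
  | A5 => exact ha.1.elim

/-- Each step of any policy gains at most what the optimality equation allows, and randomizing only
averages action values. The constant `B` absorbs `-V` at horizon zero. -/
theorem OptimalityEq.totalReward_le {g : ℝ} {V : State → ℝ} (h : P.OptimalityEq g V) {B : ℝ}
    (hB : ∀ s ∈ P.states, |V s| ≤ B) (n : ℕ) :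
    ∀ π : ℕ → DecisionRule, (∀ t, P.IsDecisionRule (π t)) → ∀ s ∈ P.states,
      P.totalReward n π s ≤ V s + (n * g + B) := by
  induction n with
  | zero =>
    intro π hπ s hs
    simp only [totalReward, Nat.cast_zero]
    linarith [abs_le.1 (hB s hs)]
  | succ n ih =>
    intro π hπ s hs
    have ih' := ih (fun t => π (t + 1)) fun t => hπ (t + 1)
    have h1 : ∑ E, P.prob s E * ∑ a, π 0 s E a *
          (P.reward s E a + P.totalReward n (fun t => π (t + 1)) (next s E a))
        ≤ ∑ E, P.prob s E * (P.bestValue V s E + (n * g + B)) := by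
      refine Finset.sum_le_sum fun E _ => ?_
      rcases P.prob_eq_zero_or_exists_feasible hs E with h' | h'
      · simp [h']
      refine mul_le_mul_of_nonneg_left ?_ (prob_nonneg s E)
      obtain ⟨hpos, hsum, hfeas⟩ := hπ 0 s hs E h'
      calc _ ≤ ∑ a, π 0 s E a * (P.bestValue V s E + (n * g + B)) := by
            refine Finset.sum_le_sum fun a _ => ?_
            by_cases ha : π 0 s E a = 0
            · simp [ha]
            refine mul_le_mul_of_nonneg_left ?_ (hpos a)
            have h2 := actionValue_le_bestValue (V := V) (hfeas a ha)
            have h3 := ih' _ (next_mem_states (hfeas a ha))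
            simp only [actionValue] at h2
            linarith
        _ = _ := by rw [← Finset.sum_mul, hsum, one_mul]
    have h2 := mul_le_mul_of_nonneg_left (ih' s hs) (P.sum_prob_le_one hs)
    have h3 := h s hs
    simp only [bellman_eq] at h3
    simp only [mul_add (P.prob s _) _ (n * g + B), Finset.sum_add_distrib, ← Finset.sum_mul] at h1
    simp only [totalReward]
    push_cast
    linarith

/-- A greedy policy attains the maximum at every step, so the same telescoping bounds its reward
from below. -/
theorem OptimalityEq.le_totalReward {g : ℝ} {V : State → ℝ} (h : P.OptimalityEq g V) {B : ℝ}
    (hB : ∀ s ∈ P.states, |V s| ≤ B) {φ : State → Event → Action}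
    (hφ : ∀ s ∈ P.states, ∀ E, (∃ a, P.Feasible s E a) → P.IsOptimalAction V s E (φ s E)) (n : ℕ) :
    ∀ s ∈ P.states, V s + (n * g - B) ≤ P.totalReward n (fun _ => pureRule φ) s := by
  induction n with
  | zero =>
    intro s hs
    simp only [totalReward, Nat.cast_zero]
    linarith [abs_le.1 (hB s hs)]
  | succ n ih =>
    intro s hs
    have h1 : ∑ E, P.prob s E * (P.bestValue V s E + (n * g - B))
        ≤ ∑ E, P.prob s E * ∑ a, pureRule φ s E a *
          (P.reward s E a + P.totalReward n (fun _ => pureRule φ) (next s E a)) := by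
      refine Finset.sum_le_sum fun E _ => ?_
      rcases P.prob_eq_zero_or_exists_feasible hs E with h' | h'
      · simp [h']
      refine mul_le_mul_of_nonneg_left ?_ (prob_nonneg s E)
      have h2 := (hφ s hs E h').actionValue_eq
      have h3 := ih _ (next_mem_states (hφ s hs E h').1)
      simp only [actionValue] at h2
      simp only [pureRule, ite_mul, one_mul, zero_mul, Finset.sum_ite_eq', Finset.mem_univ, if_true]
        at h3 ⊢
      linarith
    have h2 := mul_le_mul_of_nonneg_left (ih s hs) (P.sum_prob_le_one hs)
    have h3 := h s hs
    simp only [bellman_eq] at h3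
    simp only [mul_add (P.prob s _) _ (n * g - B), Finset.sum_add_distrib, ← Finset.sum_mul] at h1
    simp only [totalReward]
    push_cast
    linarith

theorem isDecisionRule_pureRule {φ : State → Event → Action}
    (hφ : ∀ s ∈ P.states, ∀ E, (∃ a, P.Feasible s E a) → P.Feasible s E (φ s E)) :
    P.IsDecisionRule (pureRule φ) := by
  intro s hs E hE
  refine ⟨fun a => ?_, by simp [pureRule], fun a ha => ?_⟩
  · simp only [pureRule]
    split_ifs <;> norm_num
  · have : a = φ s E := by
      by_contra hne
      simp [pureRule, hne] at ha
    exact this ▸ hφ s hs E hE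

/-- A stationary policy that is greedy with respect to a value function is average optimal. -/
theorem OptimalityEq.isAverageOptimal {g : ℝ} {V : State → ℝ} (h : P.OptimalityEq g V)
    {φ : State → Event → Action}
    (hφ : ∀ s ∈ P.states, ∀ E, (∃ a, P.Feasible s E a) → P.IsOptimalAction V s E (φ s E)) :
    P.IsAverageOptimal φ := by
  obtain ⟨B, hB⟩ := P.exists_abs_le V
  have hrule := isDecisionRule_pureRule fun s hs E hE => (hφ s hs E hE).1
  have hlim : ∀ c : ℝ, Tendsto (fun n : ℕ => g + c / n) atTop (𝓝 g) := fun c => by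
    simpa using (tendsto_const_div_atTop_nhds_zero_nat c).const_add g
  have hup : ∀ π : ℕ → DecisionRule, (∀ t, P.IsDecisionRule (π t)) → ∀ s ∈ P.states,
      ∀ᶠ n : ℕ in atTop, P.totalReward n π s / n ≤ g + (V s + B) / n := by
    intro π hπ s hs
    filter_upwards [eventually_gt_atTop 0] with n hn
    have hn' : (0 : ℝ) < n := by exact_mod_cast hn
    rw [div_le_iff₀ hn', add_mul, div_mul_cancel₀ _ hn'.ne']
    linarith [h.totalReward_le hB n π hπ s hs]
  refine ⟨hrule, g, fun s hs => ?_, fun π hπ s hs ε hε => ?_⟩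
  · refine tendsto_of_tendsto_of_tendsto_of_le_of_le' (hlim (V s - B)) (hlim (V s + B)) ?_
      (hup _ (fun _ => hrule) s hs)
    filter_upwards [eventually_gt_atTop 0] with n hn
    have hn' : (0 : ℝ) < n := by exact_mod_cast hn
    rw [le_div_iff₀ hn', add_mul, div_mul_cancel₀ _ hn'.ne']
    linarith [h.le_totalReward hB hφ n s hs]
  · filter_upwards [hup π hπ s hs, (hlim (V s + B)).eventually_lt_const (lt_add_of_pos_right g hε)]
      with n h1 h2
    exact h1.trans h2.le

theorem OptimalityEq.exists_greedy {kth : ℕ} (hkth : P.IsThreshold kth) {g : ℝ} {V : State → ℝ}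
    (h : P.OptimalityEq g V) : ∃ φ : State → Event → Action,
      (∀ s ∈ P.states, ∀ E, (∃ a, P.Feasible s E a) → P.IsOptimalAction V s E (φ s E)) ∧
      ∀ i j k : ℕ, i + j < P.C → k ≤ P.W → kth ≤ k →
        φ ⟨i, j, k⟩ .voiceArrival = .A2 ∨ φ ⟨i, j, k⟩ .voiceArrival = .A1 := by
  -- Ties need breaking only from the threshold on; below it, when `A4` is feasible, every optimal
  -- action already qualifies.
  have hex : ∀ s E, ∃ a, ((∃ a, P.Feasible s E a) → P.IsOptimalAction V s E a) ∧
      (E = .voiceArrival → s.i + s.j < P.C → s.k ≤ P.W → kth ≤ s.k → a = .A2 ∨ a = .A1) := by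
    intro s E
    by_cases hc : E = .voiceArrival ∧ s.i + s.j < P.C ∧ s.k ≤ P.W ∧ kth ≤ s.k
    · obtain ⟨rfl, h1, h2, h3⟩ := hc
      obtain ⟨a, ha, ha'⟩ := exists_isOptimalAction_eq hkth (h.unimodal hkth) h1 h2 h3
      exact ⟨a, fun _ => ha, fun _ _ _ _ => ha'⟩
    · by_cases hne : ∃ a, P.Feasible s E a
      · obtain ⟨a, ha⟩ := P.exists_isOptimalAction V hne
        exact ⟨a, fun _ => ha, fun h0 h1 h2 h3 => absurd ⟨h0, h1, h2, h3⟩ hc⟩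
      · exact ⟨.A1, fun h => absurd h hne, fun _ _ _ _ => .inr rfl⟩
  choose φ hφ using hex
  exact ⟨φ, fun s _ E hE => (hφ s E).1 hE, fun i j k h1 h2 h3 => (hφ ⟨i, j, k⟩ _).2 rfl h1 h2 h3⟩

end Params

end HetNet

theorem lemma4 (P : HetNet.Params) (kth : ℕ) (hkth : P.IsThreshold kth) :
    -- comparison of the actions, for the iterates of value iteration and for every value function
    (∀ V : HetNet.State → ℝ, ((∃ n, V = P.valueIter n) ∨ ∃ g, P.OptimalityEq g V) →
      ∀ i j k : ℕ, i + j < P.C → k ≤ P.W →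
        (k < kth → P.Feasible ⟨i, j, k⟩ .voiceArrival .A4 →
          P.actionValue V ⟨i, j, k⟩ .voiceArrival .A2
              < P.actionValue V ⟨i, j, k⟩ .voiceArrival .A4 ∧
          ∀ a, P.IsOptimalAction V ⟨i, j, k⟩ .voiceArrival a → a = .A4 ∨ a = .A1) ∧
        (kth ≤ k →
          (P.Feasible ⟨i, j, k⟩ .voiceArrival .A4 →
            P.actionValue V ⟨i, j, k⟩ .voiceArrival .A4
              ≤ P.actionValue V ⟨i, j, k⟩ .voiceArrival .A2) ∧
          ∃ a, P.IsOptimalAction V ⟨i, j, k⟩ .voiceArrival a ∧ (a = .A2 ∨ a = .A1))) ∧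
    -- a value function exists
    (∃ g V, P.OptimalityEq g V) ∧
    -- some average-optimal policy only chooses between the better action and blocking
    (∃ φ : HetNet.State → HetNet.Event → HetNet.Action, P.IsAverageOptimal φ ∧
      ∀ i j k : ℕ, i + j < P.C → k ≤ P.W →
        (k < kth → P.Feasible ⟨i, j, k⟩ .voiceArrival .A4 →
          φ ⟨i, j, k⟩ .voiceArrival = .A4 ∨ φ ⟨i, j, k⟩ .voiceArrival = .A1) ∧
        (kth ≤ k →
          φ ⟨i, j, k⟩ .voiceArrival = .A2 ∨ φ ⟨i, j, k⟩ .voiceArrival = .A1)) := by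
  refine ⟨fun V hV i j k hij hk => ?_, P.exists_optimalityEq, ?_⟩
  · have hU : P.Unimodal kth V := by
      rcases hV with ⟨n, rfl⟩ | ⟨g, hg⟩
      · exact HetNet.Params.unimodal_valueIter hkth n
      · exact hg.unimodal hkth
    exact ⟨fun hlt hf => ⟨HetNet.Params.voiceArrival_lt hkth hU hij hk hlt hf,
        fun a ha => HetNet.Params.eq_of_isOptimalAction hkth hU hij hk hlt hf ha⟩,
      fun hle => ⟨HetNet.Params.voiceArrival_le hkth hU hij hk hle,
        HetNet.Params.exists_isOptimalAction_eq hkth hU hij hk hle⟩⟩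
  · obtain ⟨g, V, h⟩ := P.exists_optimalityEq
    obtain ⟨φ, hφ, hφ'⟩ := h.exists_greedy hkth
    refine ⟨φ, h.isAverageOptimal hφ, fun i j k hij hk => ⟨fun hlt hf => ?_, hφ' i j k hij hk⟩⟩
    exact HetNet.Params.eq_of_isOptimalAction hkth (h.unimodal hkth) hij hk hlt hf
      (hφ _ ⟨hij.le, hk⟩ _ ⟨_, hf⟩)
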